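/- Fix $p\in[\frac12,1]$ and consider the following zero-sum repeated game. The system is in one of two states $\underline s,\bar s$; between stages it stays in its current state with probability $p$ and switches with probability $1-p$. At each stage Player 1 plays $T$ or $B$ and Player 2 simultaneously plays $L$ or $R$; Player 1 receives $1$ from Player 2 if the state is $\underline s$ and the moves are $(T,L)$, or if the state is $\bar s$ and the moves are $(B,R)$, and $0$ otherwise. Player 1 knows all past states and moves and the current state before he moves; Player 2 knows only the past moves of both players. Strategies are behaviour strategies: the probability of playing $T$ (resp. $L$) is an arbitrary function of the information available. A number $v$ is the value of the game if Player 1 has a strategy such that, for every initial law of the state and every strategy of Player 2, the $\liminf$ of the expected average gain of Player 1 over the first $n$ stages is at least $v$, and Player 2 has a strategy such that, for every initial law and every strategy of Player 1, the $\limsup$ is at most $v$. A strategy of Player 1 is optimal if the game has a value $v$ and the strategy guarantees $v$ in this sense. Put $\gamma=2p-1$ and, for $\theta\in[0,1]$, $$f_B(\theta)=\begin{cases}p\frac{2\theta-1}{\theta}+(1-p)\frac{1-\theta}{\theta}&\theta\ge\frac12\\1-p&\theta\le\frac12\end{cases},\qquad f_T(\theta)=\begin{cases}p&\theta\ge\frac12\\p\frac{\theta}{1-\theta}+(1-p)\frac{1-2\theta}{1-\theta}&\theta\le\frac12\end{cases},$$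 and $\Phi(\theta)=f_B(\theta)$ if $\theta\ge\frac12$, $\Phi(\theta)=f_T(\theta)$ if $\theta<\frac12$; $\Phi$ maps $[1-p,p]$ into itself. The strategy $\sigma^*$ of Player 1 keeps an internal variable $\theta\in[0,1]$, with an arbitrary initial value $\theta_0$. If $\theta\le\frac12$ it plays $T$ with probability $1$ in state $\underline s$ and $\frac{1-2\theta}{1-\theta}$ in state $\bar s$; if $\theta\ge\frac12$ it plays $T$ with probability $\frac{1-\theta}{\theta}$ in state $\underline s$ and $0$ in state $\bar s$. After playing $T$ (resp. $B$), $\theta$ is replaced by $f_T(\theta)$ (resp. $f_B(\theta)$). Suppose that $p$ satisfies $$\sum_{n\ge0}\ \sum_{\theta\in[1-p,p],\ \Phi^n(\theta)=\frac12}\ \prod_{i=0}^{n-1}\frac{\gamma}{\max(\Phi^i(\theta),1-\Phi^i(\theta))}<\infty .$$ Then, for every initial value $\theta_0\in[0,1]$, $\sigma^*$ is an optimal strategy for Player 1. -/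

import Mathlib

namespace AsymmetricGame

open Filter unitInterval

/-- The two states of the system: `lo` is the state with payoff matrix `(1 0; 0 0)`,
`hi` is the state with payoff matrix `(0 0; 0 1)`. -/
inductive State
  | lo
  | hi

/-- Moves of Player 1: top and bottom. -/
inductive Move₁
  | T
  | B

/-- Moves of Player 2: left and right. -/
inductive Move₂
  | L
  | R

/-- What happens in one stage: the state of the system and the moves of the two players. -/
abbrev Stage := State × Move₁ × Move₂

/-- The amount that Player 1 receives in a stage. -/
def payoff : Stage → ℝ
  | (State.lo, Move₁.T, Move₂.L) => 1
  | (State.hi, Move₁.B, Move₂.R) => 1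
  | _ => 0

/-- A (behaviour) strategy of Player 1: the probability of playing `T`, as a function of the
past stages (most recent first; Player 1 knows the past states and all past moves) and of the
current state. -/
abbrev Strategy₁ := List Stage → State → I

/-- A (behaviour) strategy of Player 2: the probability of playing `L`, as a function of the past
moves of both players (most recent first); Player 2 never sees the states. -/
abbrev Strategy₂ := List (Move₁ × Move₂) → I

/-- The law that gives mass `t` to `x` and mass `1 - t` to `y`. -/
noncomputable def choice {α : Type} (t : I) (x y : α) : PMF α :=
  (PMF.ofFintype (fun b : Bool => ENNReal.ofReal (if b then (t : ℝ) else 1 - t)) (by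
    have h0 := t.2.1
    have h1 := t.2.2
    simp only [Fintype.sum_bool, if_true, Bool.false_eq_true, if_false]
    rw [← ENNReal.ofReal_add h0 (by linarith)]
    simp)).map (fun b => if b then x else y)

/-- The law of the next state: the system stays in its state with probability `p` and switches
with probability `1 - p`. -/
noncomputable def nextState (p : I) : State → PMF State
  | State.lo => choice p State.lo State.hi
  | State.hi => choice p State.hi State.lo

/-- The joint law of the first `n` stages (most recent first) and of the state in which the
following stage is played, if the initial state is `lo` with probability `q` and the players use
the strategies `s₁` and `s₂`. Given the past and the current state, the two players randomize
independently. -/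
noncomputable def playLaw (p q : I) (s₁ : Strategy₁) (s₂ : Strategy₂) :
    ℕ → PMF (List Stage × State)
  | 0 => (choice q State.lo State.hi).map fun s => ([], s)
  | n + 1 =>
    (playLaw p q s₁ s₂ n).bind fun z =>
      (choice (s₁ z.1 z.2) Move₁.T Move₁.B).bind fun a =>
        (choice (s₂ (z.1.map Prod.snd)) Move₂.L Move₂.R).bind fun b =>
          (nextState p z.2).map fun s' => ((z.2, a, b) :: z.1, s')

/-- The expected average gain of Player 1 per stage over the first `n` stages. -/
noncomputable def averageGain (p q : I) (s₁ : Strategy₁) (s₂ : Strategy₂) (n : ℕ) : ℝ :=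
  (∑' z : List Stage × State,
    (playLaw p q s₁ s₂ n z).toReal * (z.1.map payoff).sum) / n

/-- Using `s₁`, Player 1 has long-term expected gain at least `v`, whatever the initial law and
whatever Player 2 does: the lower limit of the expected average gains is at least `v`. -/
def Guarantees₁ (p : I) (s₁ : Strategy₁) (v : ℝ) : Prop :=
  ∀ (q : I) (s₂ : Strategy₂), ∀ w < v, ∀ᶠ n in atTop, w < averageGain p q s₁ s₂ n

/-- If Player 2 uses `s₂`, then Player 1 has long-term expected gain at most `v`, whatever the
initial law and whatever Player 1 does: the upper limit of the expected average gains is at most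
`v`. -/
def Guarantees₂ (p : I) (s₂ : Strategy₂) (v : ℝ) : Prop :=
  ∀ (q : I) (s₁ : Strategy₁), ∀ w > v, ∀ᶠ n in atTop, averageGain p q s₁ s₂ n < w

/-- `v` is the value of the game: Player 1 can guarantee at least `v` and Player 2 can guarantee
at most `v`. -/
def IsValue (p : I) (v : ℝ) : Prop :=
  (∃ s₁, Guarantees₁ p s₁ v) ∧ (∃ s₂, Guarantees₂ p s₂ v)

/-- `s₁` is an optimal strategy of Player 1: it guarantees the value of the game. -/
def IsOptimal₁ (p : I) (s₁ : Strategy₁) : Prop :=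
  ∃ v, IsValue p v ∧ Guarantees₁ p s₁ v

/-- The map `f_B`. -/
noncomputable def fB (p θ : ℝ) : ℝ :=
  if 1 / 2 ≤ θ then p * ((2 * θ - 1) / θ) + (1 - p) * ((1 - θ) / θ) else 1 - p

/-- The map `f_T`. -/
noncomputable def fT (p θ : ℝ) : ℝ :=
  if 1 / 2 ≤ θ then p else p * (θ / (1 - θ)) + (1 - p) * ((1 - 2 * θ) / (1 - θ))

/-- The map `Φ`. -/
noncomputable def Phi (p θ : ℝ) : ℝ :=
  if 1 / 2 ≤ θ then fB p θ else fT p θ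

/-- The probability with which `σ*` plays `T` if the internal state is `θ`. -/
noncomputable def probT (θ : ℝ) : State → ℝ
  | State.lo => if θ ≤ 1 / 2 then 1 else (1 - θ) / θ
  | State.hi => if θ ≤ 1 / 2 then (1 - 2 * θ) / (1 - θ) else 0

theorem fB_mem (p θ : I) : fB p θ ∈ I := by
  obtain ⟨p, hp0, hp1⟩ := p
  obtain ⟨θ, h0, h1⟩ := θ
  unfold fB
  simp only
  split_ifs with h
  · have hθ : 0 < θ := by linarith
    have e : p * ((2 * θ - 1) / θ) + (1 - p) * ((1 - θ) / θ)
        = (p * (2 * θ - 1) + (1 - p) * (1 - θ)) / θ := by ring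
    rw [e]
    constructor
    · apply div_nonneg _ h0
      nlinarith
    · rw [div_le_one hθ]
      nlinarith
  · constructor <;> linarith

theorem fT_mem (p θ : I) : fT p θ ∈ I := by
  obtain ⟨p, hp0, hp1⟩ := p
  obtain ⟨θ, h0, h1⟩ := θ
  unfold fT
  simp only
  split_ifs with h
  · exact ⟨hp0, hp1⟩
  · have hθ : 0 < 1 - θ := by linarith
    have e : p * (θ / (1 - θ)) + (1 - p) * ((1 - 2 * θ) / (1 - θ))
        = (p * θ + (1 - p) * (1 - 2 * θ)) / (1 - θ) := by ring
    rw [e]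
    constructor
    · apply div_nonneg _ hθ.le
      nlinarith
    · rw [div_le_one hθ]
      nlinarith

theorem probT_mem (θ : I) (s : State) : probT θ s ∈ I := by
  obtain ⟨θ, h0, h1⟩ := θ
  cases s <;> simp only [probT] <;> split_ifs with h
  · simp
  · constructor
    · exact div_nonneg (by linarith) h0
    · rw [div_le_one (by linarith)]; linarith
  · constructor
    · exact div_nonneg (by linarith) (by linarith)
    · rw [div_le_one (by linarith)]; linarith
  · simp

/-- The internal state `θ` of Player 1 after the given moves of Player 1 (most recent first), if
it was `θ₀` at the beginning. -/
noncomputable def belief (p θ₀ : I) : List Move₁ → I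
  | [] => θ₀
  | Move₁.T :: h => ⟨fT p (belief p θ₀ h), fT_mem p _⟩
  | Move₁.B :: h => ⟨fB p (belief p θ₀ h), fB_mem p _⟩

/-- The strategy `σ*` with initial internal state `θ₀`. -/
noncomputable def sigmaStar (p θ₀ : I) : Strategy₁ := fun h s =>
  ⟨probT (belief p θ₀ (h.map fun z => z.2.1)) s, probT_mem _ s⟩

/-- `Z_n = ∑_{θ ∈ Φ⁻ⁿ(1/2)} ∏_{i < n} γ / max (Φⁱ θ, 1 - Φⁱ θ)` with `γ = 2 p - 1`, where `Φ` is
regarded as a map of the interval `[1 - p, p]` to itself. -/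
noncomputable def pressureSum (p : ℝ) (n : ℕ) : ENNReal :=
  ∑' θ : {θ : ℝ // θ ∈ Set.Icc (1 - p) p ∧ (Phi p)^[n] θ = 1 / 2},
    ∏ i ∈ Finset.range n,
      ENNReal.ofReal ((2 * p - 1) / max ((Phi p)^[i] θ) (1 - (Phi p)^[i] θ))

end AsymmetricGame

/-!
Let `θ` be the probability of the state `lo` given the past moves. Under `σ*` it equals the
internal state, and the Bellman equation of the game on beliefs is

`v + V θ = min θ (1 - θ) + (1 - θ) * V (fT p θ) + θ * V (fB p θ)`.

A solution is `V θ = -c * ∑' a, m a * |θ - a|` on `[1 - p, p]`, where `m` puts on every iterated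
preimage `a` of `1 / 2` under `Φ` the product of the ratios `γ / max (Φⁱ a, 1 - Φⁱ a)`: the kink of
`min θ (1 - θ)` at `1 / 2` is pulled back by `Φ`, which gives a transfer equation for `m`, and the
series that is assumed to converge is the total mass of `m`. Since `V` is concave, Player 2
guarantees `v` by playing against its tangents: if the belief is `θ`, the continuation value in the
states `lo` and `hi` is the value at `1` and `0` of the tangent to `V` at `θ`. For Player 1, the
internal state of `σ*` need not be the conditional law of the state, but the expected error shrinks
by the factor `γ < 1` in every stage, because the moves of `σ*` obey Bayes' rule for any `θ`.
-/

namespace AsymmetricGame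

open Filter Set unitInterval

/-! ### The maps `fB`, `fT` and `Φ` -/

section Maps

variable {p θ : ℝ}

theorem fB_of_half_le (hθ : 1 / 2 ≤ θ) : fB p θ = 3 * p - 1 - (2 * p - 1) / θ := by
  have : θ ≠ 0 := by linarith
  rw [fB, if_pos hθ]
  field_simp
  ring

theorem fB_half (p : ℝ) : fB p (1 / 2) = 1 - p := by
  norm_num [fB]

theorem fT_of_half_le (hθ : 1 / 2 ≤ θ) : fT p θ = p := if_pos hθ

theorem fT_one_sub (p θ : ℝ) : fT p (1 - θ) = 1 - fB p θ := by
  rcases lt_trichotomy θ (1 / 2) with h | rfl | h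
  · rw [fT_of_half_le (by linarith), fB, if_neg h.not_ge, sub_sub_cancel]
  · norm_num [fT, fB]
  · have : θ ≠ 0 := by linarith
    rw [fB_of_half_le h.le, fT, if_neg (by linarith), sub_sub_cancel]
    field_simp
    ring

theorem fB_one_sub (p θ : ℝ) : fB p (1 - θ) = 1 - fT p θ := by
  have h := fT_one_sub p (1 - θ)
  rw [sub_sub_cancel] at h
  rw [h, sub_sub_cancel]

theorem mul_fB (p θ : ℝ) :
    θ * fB p θ = (θ - min θ (1 - θ)) * p + min θ (1 - θ) * (1 - p) := by
  by_cases h : 1 / 2 ≤ θ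
  · have : θ ≠ 0 := by linarith
    rw [fB_of_half_le h, min_eq_right (by linarith)]
    field_simp
    ring
  · rw [fB, if_neg h, min_eq_left (by linarith)]
    ring

theorem one_sub_mul_fT (p θ : ℝ) :
    (1 - θ) * fT p θ = min θ (1 - θ) * p + (1 - θ - min θ (1 - θ)) * (1 - p) := by
  have h := mul_fB p (1 - θ)
  rw [fB_one_sub, sub_sub_cancel, min_comm] at h
  linarith

theorem fB_mem_Icc (hp : 1 / 2 ≤ p) (hθ : θ ≤ 1) : fB p θ ∈ Icc (1 - p) p := by
  by_cases h : 1 / 2 ≤ θ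
  · have h0 : 0 < θ := by linarith
    have hle : (2 * p - 1) / θ ≤ (2 * p - 1) * 2 := by
      rw [div_le_iff₀ h0]
      nlinarith
    have hge : 2 * p - 1 ≤ (2 * p - 1) / θ := by
      rw [le_div_iff₀ h0]
      nlinarith
    rw [fB_of_half_le h]
    constructor <;> linarith
  · rw [fB, if_neg h]
    constructor <;> linarith

theorem one_sub_mem_Icc_iff : 1 - θ ∈ Icc (1 - p) p ↔ θ ∈ Icc (1 - p) p := by
  simp only [mem_Icc, sub_le_sub_iff_left, sub_le_comm, and_comm]

theorem fT_mem_Icc (hp : 1 / 2 ≤ p) (hθ : 0 ≤ θ) : fT p θ ∈ Icc (1 - p) p := by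
  rw [← one_sub_mem_Icc_iff, ← fB_one_sub]
  exact fB_mem_Icc hp (sub_le_self 1 hθ)

theorem Phi_mem_Icc (hp : 1 / 2 ≤ p) (hθ : θ ∈ Icc 0 1) : Phi p θ ∈ Icc (1 - p) p := by
  rw [Phi]
  split_ifs
  · exact fB_mem_Icc hp hθ.2
  · exact fT_mem_Icc hp hθ.1

theorem Phi_one_sub (h : θ ≠ 1 / 2) : Phi p (1 - θ) = 1 - Phi p θ := by
  rcases lt_or_gt_of_ne h with h | h
  · rw [Phi, Phi, if_pos (by linarith), if_neg h.not_ge, fB_one_sub]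
  · rw [Phi, Phi, if_neg (by linarith), if_pos h.le, fT_one_sub]

theorem strictMonoOn_fB (hp : 1 / 2 < p) : StrictMonoOn (fB p) (Ici (1 / 2)) := by
  intro a ha b hb hab
  have ha' : 1 / 2 ≤ a := ha
  rw [fB_of_half_le ha, fB_of_half_le hb]
  exact sub_lt_sub_left (div_lt_div_of_pos_left (by linarith) (by linarith) hab) _

theorem one_sub_lt_fB (hp : 1 / 2 < p) (hθ : 1 / 2 < θ) : 1 - p < fB p θ := by
  rw [← fB_half p]
  exact strictMonoOn_fB hp self_mem_Ici hθ.le hθ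

theorem fB_image_Ioc (hp : 1 / 2 < p) : fB p '' Ioc (1 / 2) p = Ioc (1 - p) (fB p p) := by
  have hmono := strictMonoOn_fB hp
  refine Subset.antisymm (image_subset_iff.2 fun a ha =>
    ⟨one_sub_lt_fB hp ha.1, hmono.monotoneOn ha.1.le hp.le ha.2⟩) fun b hb => ?_
  have hcont : ContinuousOn (fB p) (Icc (1 / 2) p) := by
    refine ContinuousOn.congr (f := fun θ => 3 * p - 1 - (2 * p - 1) / θ) ?_
      fun θ hθ => fB_of_half_le hθ.1
    exact continuousOn_const.sub (continuousOn_const.div continuousOn_id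
      fun θ hθ => (one_half_pos.trans_le hθ.1).ne')
  rw [← fB_half p] at hb
  exact intermediate_value_Ioc hp.le hcont hb

end Maps

theorem sign_sub_of_strictMonoOn {f : ℝ → ℝ} {s : Set ℝ} (hf : StrictMonoOn f s) {x y : ℝ}
    (hx : x ∈ s) (hy : y ∈ s) : Real.sign (f x - f y) = Real.sign (x - y) := by
  rcases lt_trichotomy x y with h | rfl | h
  · rw [Real.sign_of_neg (sub_neg.2 (hf hx hy h)), Real.sign_of_neg (sub_neg.2 h)]
  · simp only [sub_self]
  · rw [Real.sign_of_pos (sub_pos.2 (hf hy hx h)), Real.sign_of_pos (sub_pos.2 h)]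

theorem abs_sign_le_one (x : ℝ) : |Real.sign x| ≤ 1 := by
  rcases Real.sign_apply_eq x with h | h | h <;> rw [h] <;> norm_num

/-! ### The mass of the kinks -/

/-- The notion of a mass distribution on the kinks of the value function: a symmetric summable
mass carried by `[1 - p, p]` that solves the transfer equation of `Φ` with a unit source at
`1 / 2`. The standing assumption `p ∈ [1 / 2, 1]` is part of the structure. -/
structure IsKinkMass (p : ℝ) (m : ℝ → ℝ) : Prop where
  half_le : 1 / 2 ≤ p
  le_one : p ≤ 1
  nonneg : ∀ a, 0 ≤ m a
  summable : Summable m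
  apply_of_notMem : ∀ a ∉ Icc (1 - p) p, m a = 0
  apply_one_sub : ∀ a, m (1 - a) = m a
  apply_eq : ∀ a ∈ Icc (1 - p) p,
    m a = (if a = 1 / 2 then 1 else 0) + (2 * p - 1) / max a (1 - a) * m (Phi p a)

section Existence

variable {p : ℝ}

/-- The contribution of `a` to `pressureSum p n`, which is `0` unless `Φⁿ a = 1 / 2`. -/
noncomputable def preimageWeight (p : ℝ) (n : ℕ) : ℝ → ENNReal :=
  indicator {θ : ℝ | θ ∈ Icc (1 - p) p ∧ (Phi p)^[n] θ = 1 / 2} fun θ =>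
    ∏ i ∈ Finset.range n,
      ENNReal.ofReal ((2 * p - 1) / max ((Phi p)^[i] θ) (1 - (Phi p)^[i] θ))

theorem tsum_preimageWeight (p : ℝ) (n : ℕ) :
    ∑' a, preimageWeight p n a = pressureSum p n := by
  rw [preimageWeight, ← tsum_subtype]
  rfl

theorem preimageWeight_of_notMem (n : ℕ) {a : ℝ} (ha : a ∉ Icc (1 - p) p) :
    preimageWeight p n a = 0 :=
  indicator_of_notMem (fun h => ha h.1) _

theorem preimageWeight_zero {a : ℝ} (ha : a ∈ Icc (1 - p) p) :
    preimageWeight p 0 a = if a = 1 / 2 then 1 else 0 := by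
  simp only [preimageWeight, indicator_apply, mem_ofPred_eq, ha, true_and, Function.iterate_zero,
    id, Finset.range_zero, Finset.prod_empty]

theorem preimageWeight_succ (hp : 1 / 2 ≤ p) (hp1 : p ≤ 1) (n : ℕ) {a : ℝ}
    (ha : a ∈ Icc (1 - p) p) :
    preimageWeight p (n + 1) a =
      ENNReal.ofReal ((2 * p - 1) / max a (1 - a)) * preimageWeight p n (Phi p a) := by
  have hPhi : Phi p a ∈ Icc (1 - p) p :=
    Phi_mem_Icc hp ⟨by linarith [ha.1], by linarith [ha.2]⟩
  simp only [preimageWeight, indicator_apply, mem_ofPred_eq, ha, hPhi, true_and,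
    Finset.prod_range_succ', Function.iterate_succ_apply, Function.iterate_zero, id, ite_mul,
    zero_mul, mul_comm (ENNReal.ofReal ((2 * p - 1) / max a (1 - a)))]

theorem preimageWeight_one_sub (hp : 1 / 2 ≤ p) (hp1 : p ≤ 1) (n : ℕ) (a : ℝ) :
    preimageWeight p n (1 - a) = preimageWeight p n a := by
  induction n generalizing a with
  | zero =>
    by_cases ha : a ∈ Icc (1 - p) p
    · have : 1 - a = 1 / 2 ↔ a = 1 / 2 := by constructor <;> intro h <;> linarith
      simp only [preimageWeight_zero ha, preimageWeight_zero (one_sub_mem_Icc_iff.2 ha), this]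
    · rw [preimageWeight_of_notMem _ ha,
        preimageWeight_of_notMem _ (one_sub_mem_Icc_iff.not.2 ha)]
  | succ n ih =>
    by_cases ha : a ∈ Icc (1 - p) p
    · rcases eq_or_ne a (1 / 2) with rfl | h
      · norm_num
      · rw [preimageWeight_succ hp hp1 n ha,
          preimageWeight_succ hp hp1 n (one_sub_mem_Icc_iff.2 ha), Phi_one_sub h, ih,
          sub_sub_cancel, max_comm]
    · rw [preimageWeight_of_notMem _ ha,
        preimageWeight_of_notMem _ (one_sub_mem_Icc_iff.not.2 ha)]

/-- The total weight of `a` as an iterated preimage of `1 / 2` under `Φ`, which solves the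
transfer equation. It is `0` where the sum diverges. -/
noncomputable def kinkMass (p a : ℝ) : ℝ :=
  (∑' n, preimageWeight p n a).toReal

theorem tsum_tsum_preimageWeight_ne_top (hpress : ∑' n, pressureSum p n < ⊤) :
    ∑' a, ∑' n, preimageWeight p n a ≠ ⊤ := by
  rw [ENNReal.tsum_comm]
  simpa only [tsum_preimageWeight] using hpress.ne

theorem kinkMass_eq (hp : 1 / 2 ≤ p) (hp1 : p ≤ 1) (hpress : ∑' n, pressureSum p n < ⊤)
    {a : ℝ} (ha : a ∈ Icc (1 - p) p) :
    kinkMass p a =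
      (if a = 1 / 2 then 1 else 0) + (2 * p - 1) / max a (1 - a) * kinkMass p (Phi p a) := by
  have hne : ∑' n, preimageWeight p n (Phi p a) ≠ ⊤ :=
    ENNReal.ne_top_of_tsum_ne_top (tsum_tsum_preimageWeight_ne_top hpress) _
  have hratio : 0 ≤ (2 * p - 1) / max a (1 - a) :=
    div_nonneg (by linarith) (le_max_of_le_left (by linarith [ha.1]))
  have hzero : preimageWeight p 0 a ≠ ⊤ := by
    rw [preimageWeight_zero ha]
    split_ifs <;> simp
  rw [kinkMass, kinkMass, tsum_eq_zero_add' ENNReal.summable]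
  simp only [preimageWeight_succ hp hp1 _ ha]
  rw [ENNReal.tsum_mul_left,
    ENNReal.toReal_add hzero (ENNReal.mul_ne_top ENNReal.ofReal_ne_top hne), ENNReal.toReal_mul,
    ENNReal.toReal_ofReal hratio, preimageWeight_zero ha]
  split_ifs <;> simp

theorem isKinkMass_kinkMass (hp : 1 / 2 ≤ p) (hp1 : p ≤ 1)
    (hpress : ∑' n, pressureSum p n < ⊤) : IsKinkMass p (kinkMass p) where
  half_le := hp
  le_one := hp1
  nonneg _ := ENNReal.toReal_nonneg
  summable := ENNReal.summable_toReal (tsum_tsum_preimageWeight_ne_top hpress)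
  apply_of_notMem a ha := by simp [kinkMass, preimageWeight_of_notMem _ ha]
  apply_one_sub a := by simp only [kinkMass, preimageWeight_one_sub hp hp1]
  apply_eq _ ha := kinkMass_eq hp hp1 hpress ha

end Existence

namespace IsKinkMass

variable {p : ℝ} {m : ℝ → ℝ} (hm : IsKinkMass p m)

include hm

theorem apply_half : m (1 / 2) = 1 + 2 * (2 * p - 1) * m (1 - p) := by
  have hhalf : (1 / 2 : ℝ) ∈ Icc (1 - p) p := ⟨by linarith [hm.half_le], hm.half_le⟩
  have hmax : max (1 / 2 : ℝ) (1 - 1 / 2) = 1 / 2 := by norm_num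
  rw [hm.apply_eq _ hhalf, if_pos rfl, hmax, Phi, if_pos le_rfl, fB_half]
  ring

theorem apply_of_half_lt {a : ℝ} (ha : a ∈ Ioc (1 / 2) p) :
    m a = (2 * p - 1) / a * m (fB p a) := by
  have hmax : max a (1 - a) = a := max_eq_left (by linarith [ha.1])
  rw [hm.apply_eq a ⟨by linarith [hm.half_le, ha.1], ha.2⟩, if_neg ha.1.ne', hmax, Phi,
    if_pos ha.1.le, zero_add]

/- If `p = 1`, then `fB 1` maps `(n + 2) / (n + 3)` to `(n + 1) / (n + 2)` and the mass does not
decrease along this backward orbit of `1 / 2`. -/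
theorem lt_one : p < 1 := by
  refine hm.le_one.lt_of_ne ?_
  rintro rfl
  let orbit : ℕ → ℝ := fun n => (n + 1) / (n + 2)
  have horbit (n : ℕ) : 1 ≤ m (orbit n) := by
    induction n with
    | zero =>
      have h := hm.nonneg (1 - 1)
      have h' := hm.apply_half
      norm_num [orbit] at h h' ⊢
      linarith
    | succ n ih =>
      have hmem : orbit (n + 1) ∈ Ioc (1 / 2) 1 := by
        simp only [orbit, Nat.cast_add, Nat.cast_one]
        rw [mem_Ioc, div_lt_div_iff₀ (by positivity) (by positivity),
          div_le_one (by positivity)]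
        constructor <;> linarith [n.cast_nonneg (α := ℝ)]
      have himage : fB 1 (orbit (n + 1)) = orbit n := by
        rw [fB_of_half_le hmem.1.le]
        simp only [orbit, Nat.cast_add, Nat.cast_one]
        field_simp
        ring
      rw [hm.apply_of_half_lt hmem, himage]
      refine one_le_mul_of_one_le_of_one_le ?_ ih
      rw [one_le_div (by linarith [hmem.1])]
      linarith [hmem.2]
  have hinj : Function.Injective orbit := by
    intro n k h
    simp only [orbit] at h
    rw [div_eq_div_iff (by positivity) (by positivity)] at h
    exact_mod_cast (by linarith : (n : ℝ) = k)
  have hlim := (hm.summable.comp_injective hinj).tendsto_atTop_zero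
  exact absurd (ge_of_tendsto' hlim horbit) (by norm_num)

theorem summable_mul_of_abs_le {φ : ℝ → ℝ} {K : ℝ} (hφ : ∀ a ∈ Icc (1 - p) p, |φ a| ≤ K) :
    Summable fun a => m a * φ a := by
  refine Summable.of_norm_bounded (hm.summable.mul_right K) fun a => ?_
  by_cases ha : a ∈ Icc (1 - p) p
  · rw [Real.norm_eq_abs, abs_mul, abs_of_nonneg (hm.nonneg a)]
    exact mul_le_mul_of_nonneg_left (hφ a ha) (hm.nonneg a)
  · simp [hm.apply_of_notMem a ha]

theorem summable_mul {φ : ℝ → ℝ} (hφ : ContinuousOn φ (Icc (1 - p) p)) :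
    Summable fun a => m a * φ a := by
  obtain ⟨K, hK⟩ := isCompact_Icc.exists_bound_of_continuousOn hφ
  exact hm.summable_mul_of_abs_le hK

theorem summable_sign_mul {φ : ℝ → ℝ} (hφ : ContinuousOn φ (Icc (1 - p) p)) (θ : ℝ) :
    Summable fun a => m a * (Real.sign (θ - a) * φ a) := by
  obtain ⟨K, hK⟩ := isCompact_Icc.exists_bound_of_continuousOn hφ
  refine hm.summable_mul_of_abs_le (K := K) fun a ha => ?_
  rw [abs_mul]
  exact (mul_le_of_le_one_left (abs_nonneg _) (abs_sign_le_one _)).trans (hK a ha)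

theorem tsum_indicator_fB {φ ψ : ℝ → ℝ} (hp : 1 / 2 < p)
    (h : ∀ a ∈ Ioc (1 / 2) p, φ (fB p a) = ψ a * ((2 * p - 1) / a)) :
    ∑' b, (Ioc (1 - p) (fB p p)).indicator (fun b => m b * φ b) b =
      ∑' a, (Ioc (1 / 2) p).indicator (fun a => m a * ψ a) a := by
  have hinj : InjOn (fB p) (Ioc (1 / 2) p) :=
    (strictMonoOn_fB hp).injOn.mono fun _ ha => ha.1.le
  rw [← fB_image_Ioc hp, ← tsum_subtype, ← tsum_subtype,
    tsum_image (fun b => m b * φ b) hinj]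
  refine tsum_congr fun a => ?_
  rw [h a a.2, hm.apply_of_half_lt a.2]
  ring

theorem tsum_sign_add_one_mul {φ : ℝ → ℝ} {τ c : ℝ} (hφ : ContinuousOn φ (Icc (1 - p) p))
    (hτ : τ ∈ Ioc (1 - p) c) :
    ∑' b, m b * ((Real.sign (τ - b) + 1) * φ b) = 2 * (m (1 - p) * φ (1 - p)) +
      ∑' b, (Ioc (1 - p) c).indicator (fun b => m b * ((Real.sign (τ - b) + 1) * φ b)) b := by
  have hsum : Summable fun b => m b * ((Real.sign (τ - b) + 1) * φ b) :=
    ((hm.summable_sign_mul hφ τ).add (hm.summable_mul hφ)).congr fun b => by ring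
  rw [hsum.tsum_eq_add_tsum_ite (1 - p), Real.sign_of_pos (sub_pos.2 hτ.1)]
  congr 1
  · ring
  refine tsum_congr fun b => ?_
  rcases lt_trichotomy b (1 - p) with hb | rfl | hb
  · rw [if_neg hb.ne, indicator_of_notMem fun h => hb.not_gt h.1,
      hm.apply_of_notMem b fun h => hb.not_ge h.1, zero_mul]
  · rw [if_pos rfl, indicator_of_notMem fun h => h.1.false]
  · rw [if_neg hb.ne']
    by_cases hbc : b ≤ c
    · rw [indicator_of_mem (mem_Ioc.2 ⟨hb, hbc⟩)]
    · rw [indicator_of_notMem fun h => hbc h.2, Real.sign_of_neg (by linarith [hτ.2])]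
      ring

theorem tsum_sign_sub_sign_half_mul {ψ : ℝ → ℝ} {θ : ℝ} (hψ : ContinuousOn ψ (Icc (1 - p) p))
    (hθ : 1 / 2 < θ) :
    ∑' a, m a * ((Real.sign (θ - a) - Real.sign (1 / 2 - a)) * ψ a) = m (1 / 2) * ψ (1 / 2) +
      ∑' a, (Ioc (1 / 2) p).indicator (fun a => m a * ((Real.sign (θ - a) + 1) * ψ a)) a := by
  have hsum : Summable fun a => m a * ((Real.sign (θ - a) - Real.sign (1 / 2 - a)) * ψ a) :=
    ((hm.summable_sign_mul hψ θ).sub (hm.summable_sign_mul hψ (1 / 2))).congr fun a => by ring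
  rw [hsum.tsum_eq_add_tsum_ite (1 / 2), Real.sign_of_pos (sub_pos.2 hθ), sub_self,
    Real.sign_zero]
  congr 1
  · ring
  refine tsum_congr fun a => ?_
  rcases lt_trichotomy a (1 / 2) with ha | rfl | ha
  · rw [if_neg ha.ne, indicator_of_notMem fun h => ha.not_gt h.1,
      Real.sign_of_pos (sub_pos.2 (ha.trans hθ)), Real.sign_of_pos (sub_pos.2 ha)]
    ring
  · rw [if_pos rfl, indicator_of_notMem fun h => h.1.false]
  · rw [if_neg ha.ne', Real.sign_of_neg (sub_neg.2 ha), sub_neg_eq_add]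
    by_cases hap : a ≤ p
    · rw [indicator_of_mem (mem_Ioc.2 ⟨ha, hap⟩)]
    · rw [indicator_of_notMem fun h => hap h.2, hm.apply_of_notMem a fun h => hap h.2, zero_mul]

/-- The kinks above `1 / 2` are the images of the kinks in `(1 - p, fB p p]` under the inverse of
`fB`, so that the transfer equation becomes a change of variables. -/
theorem tsum_sign_fB {φ ψ : ℝ → ℝ} {θ : ℝ} (hθ : θ ∈ Ioc (1 / 2) p)
    (hφ : ContinuousOn φ (Icc (1 - p) p)) (hψ : ContinuousOn ψ (Icc (1 - p) p))
    (h : ∀ a ∈ Ioc (1 / 2) p, φ (fB p a) = ψ a * ((2 * p - 1) / a)) :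
    ∑' b, m b * (Real.sign (fB p θ - b) * φ b) + ∑' b, m b * φ b =
      ∑' a, m a * (Real.sign (θ - a) * ψ a) - ∑' a, m a * (Real.sign (1 / 2 - a) * ψ a) -
        m (1 / 2) * ψ (1 / 2) + 2 * (m (1 - p) * φ (1 - p)) := by
  have hp : 1 / 2 < p := hθ.1.trans_le hθ.2
  have hmono := strictMonoOn_fB hp
  have hτ : fB p θ ∈ Ioc (1 - p) (fB p p) :=
    ⟨one_sub_lt_fB hp hθ.1, hmono.monotoneOn hθ.1.le hp.le hθ.2⟩
  have hmid := hm.tsum_indicator_fB (φ := fun b => (Real.sign (fB p θ - b) + 1) * φ b)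
    (ψ := fun a => (Real.sign (θ - a) + 1) * ψ a) hp fun a ha => by
      rw [sign_sub_of_strictMonoOn hmono hθ.1.le ha.1.le, h a ha]
      ring
  have hleft := hm.tsum_sign_add_one_mul hφ hτ
  have hright := hm.tsum_sign_sub_sign_half_mul hψ hθ.1
  simp only [add_mul, one_mul, mul_add, sub_mul, mul_sub] at hleft hright hmid
  rw [(hm.summable_sign_mul hφ _).tsum_add (hm.summable_mul hφ)] at hleft
  rw [(hm.summable_sign_mul hψ _).tsum_sub (hm.summable_sign_mul hψ _)] at hright
  linarith

end IsKinkMass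

/-! ### The value function and its tangents -/

/-- The mass of the kinks below `θ` minus the mass of the kinks above `θ`. -/
noncomputable def signedMass (m : ℝ → ℝ) (θ : ℝ) : ℝ :=
  ∑' a, m a * Real.sign (θ - a)

/-- The factor that turns the mass of the kinks into half the second derivative, up to sign, of
the value function. -/
noncomputable def curvature (p : ℝ) (m : ℝ → ℝ) : ℝ :=
  (1 + 2 * (2 * p - 1) * (∑' a, m a - m (1 - p)))⁻¹

/-- The value at `x` of the tangent at `θ` to the concave value function
`θ ↦ -curvature p m * ∑' a, m a * |θ - a|`. At a kink the slope is the mean of the two one-sided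
slopes, because `Real.sign 0 = 0`. -/
noncomputable def tangent (p : ℝ) (m : ℝ → ℝ) (x θ : ℝ) : ℝ :=
  -curvature p m * ∑' a, m a * (Real.sign (θ - a) * (x - a))

/-- The value of the game. The formula is what the Bellman equation at `θ = 1 / 2` requires. -/
noncomputable def gameValue (p : ℝ) (m : ℝ → ℝ) : ℝ :=
  1 / 2 + tangent p m p p - tangent p m 1 (1 / 2)

namespace IsKinkMass

variable {p : ℝ} {m : ℝ → ℝ} (hm : IsKinkMass p m)

include hm

theorem apply_left : m (1 - p) = m p := hm.apply_one_sub p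

theorem summable_sign (θ : ℝ) : Summable fun a => m a * Real.sign (θ - a) := by
  simpa only [mul_one] using hm.summable_sign_mul (φ := fun _ => 1) continuousOn_const θ

theorem signedMass_half : signedMass m (1 / 2) = 0 := by
  have h : signedMass m (1 / 2) = -signedMass m (1 / 2) := by
    rw [signedMass, ← tsum_neg, ← (Equiv.subLeft (1 : ℝ)).tsum_eq]
    refine tsum_congr fun a => ?_
    rw [Equiv.subLeft_apply, hm.apply_one_sub, ← mul_neg, ← Real.sign_neg]
    congr 2
    ring
  linarith

theorem signedMass_right : signedMass m p = ∑' a, m a - m p := by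
  rw [signedMass, (hm.summable_sign p).tsum_eq_add_tsum_ite p, hm.summable.tsum_eq_add_tsum_ite p,
    sub_self, Real.sign_zero, mul_zero, zero_add, add_sub_cancel_left]
  refine tsum_congr fun a => ?_
  rcases lt_trichotomy a p with h | rfl | h
  · rw [Real.sign_of_pos (sub_pos.2 h), mul_one]
  · rw [if_pos rfl, if_pos rfl]
  · rw [hm.apply_of_notMem a fun h' => h.not_ge h'.2, zero_mul]

theorem le_signedMass {τ : ℝ} (hτ : 1 - p < τ) :
    2 * m (1 - p) - ∑' a, m a ≤ signedMass m τ := by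
  have hle := ((hm.summable_sign τ).add hm.summable).le_tsum (1 - p) fun a _ => by
    have h := mul_nonneg (hm.nonneg a)
      (neg_le_iff_add_nonneg.1 (abs_le.1 (abs_sign_le_one (τ - a))).1)
    linarith
  rw [(hm.summable_sign τ).tsum_add hm.summable, Real.sign_of_pos (sub_pos.2 hτ)] at hle
  rw [signedMass]
  linarith

theorem tsum_mul_sub (x : ℝ) : ∑' a, m a * (x - a) = (x - 1 / 2) * ∑' a, m a := by
  have hsum (x : ℝ) : Summable fun a => m a * (x - a) := hm.summable_mul (by fun_prop)
  have hsymm : ∑' a, m a * (x - a) = ∑' a, m a * (x - (1 - a)) := by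
    rw [← (Equiv.subLeft (1 : ℝ)).tsum_eq]
    simp only [Equiv.subLeft_apply, hm.apply_one_sub]
  have hadd : ∑' a, m a * (x - a) + ∑' a, m a * (x - (1 - a)) = (2 * x - 1) * ∑' a, m a := by
    rw [← (hsum x).tsum_add (hm.summable_mul (by fun_prop)), ← tsum_mul_left]
    exact tsum_congr fun a => by ring
  linarith

theorem summable_sign_mul_sub (x θ : ℝ) : Summable fun a => m a * (Real.sign (θ - a) * (x - a)) :=
  hm.summable_sign_mul (by fun_prop) θ

theorem curvature_denom_pos : 0 < 1 + 2 * (2 * p - 1) * (∑' a, m a - m (1 - p)) := by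
  have h1 : m (1 - p) ≤ ∑' a, m a := hm.summable.le_tsum _ fun b _ => hm.nonneg b
  have h2 : 0 ≤ 2 * p - 1 := by linarith [hm.half_le]
  have h3 := mul_nonneg h2 (sub_nonneg.2 h1)
  linarith

theorem curvature_pos : 0 < curvature p m := inv_pos.2 hm.curvature_denom_pos

theorem curvature_mul :
    curvature p m * (1 + 2 * (2 * p - 1) * (∑' a, m a - m (1 - p))) = 1 :=
  inv_mul_cancel₀ hm.curvature_denom_pos.ne'

theorem tangent_sub (x y θ : ℝ) :
    tangent p m x θ - tangent p m y θ = -curvature p m * ((x - y) * signedMass m θ) := by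
  rw [tangent, tangent, signedMass, ← mul_sub,
    ← (hm.summable_sign_mul_sub x θ).tsum_sub (hm.summable_sign_mul_sub y θ),
    ← tsum_mul_left (a := x - y)]
  congr 1
  exact tsum_congr fun a => by ring

theorem tangent_affine (x θ : ℝ) :
    tangent p m x θ = x * tangent p m 1 θ + (1 - x) * tangent p m 0 θ := by
  linear_combination hm.tangent_sub x 0 θ - x * hm.tangent_sub 1 0 θ

theorem tangent_one_sub (x θ : ℝ) : tangent p m (1 - x) (1 - θ) = tangent p m x θ := by
  rw [tangent, tangent, ← (Equiv.subLeft (1 : ℝ)).tsum_eq]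
  congr 1
  refine tsum_congr fun a => ?_
  rw [Equiv.subLeft_apply, hm.apply_one_sub, sub_sub_sub_cancel_left, sub_sub_sub_cancel_left,
    ← neg_sub θ, Real.sign_neg]
  ring

theorem tangent_right : tangent p m p p = -curvature p m * ((p - 1 / 2) * ∑' a, m a) := by
  rw [tangent, ← hm.tsum_mul_sub]
  congr 1
  refine tsum_congr fun a => ?_
  rcases lt_trichotomy a p with h | rfl | h
  · rw [Real.sign_of_pos (sub_pos.2 h), one_mul]
  · rw [sub_self, mul_zero]
  · rw [hm.apply_of_notMem a fun h' => h.not_ge h'.2, zero_mul, zero_mul]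

theorem abs_tangent_le {x : ℝ} (hx : x ∈ Icc 0 1) (θ : ℝ) :
    |tangent p m x θ| ≤ curvature p m * ∑' a, m a := by
  rw [tangent, abs_mul, abs_neg, abs_of_pos hm.curvature_pos]
  refine mul_le_mul_of_nonneg_left ?_ hm.curvature_pos.le
  refine tsum_of_norm_bounded (f := fun a => m a * (Real.sign (θ - a) * (x - a)))
    hm.summable.hasSum fun a => ?_
  by_cases ha : a ∈ Icc (1 - p) p
  · have hxa : |x - a| ≤ 1 :=
      abs_le.2 ⟨by linarith [hx.1, ha.2, hm.le_one], by linarith [hx.2, ha.1, hm.le_one]⟩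
    rw [norm_mul, norm_mul, Real.norm_of_nonneg (hm.nonneg a)]
    exact mul_le_of_le_one_right (hm.nonneg a)
      (mul_le_one₀ (abs_sign_le_one _) (abs_nonneg _) hxa)
  · simp [hm.apply_of_notMem a ha]

theorem gameValue_add_tangent_one {θ : ℝ} (hθ : θ ∈ Ioc (1 / 2) p) :
    gameValue p m + tangent p m 1 θ = tangent p m p (fB p θ) := by
  have htransfer := hm.tsum_sign_fB (φ := fun b => p - b) (ψ := fun a => 1 - a) hθ
    (by fun_prop) (by fun_prop) fun a ha => by
      have : a ≠ 0 := by linarith [ha.1]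
      rw [fB_of_half_le ha.1.le]
      field_simp
      ring
  rw [hm.tsum_mul_sub, hm.apply_half] at htransfer
  rw [gameValue, hm.tangent_right]
  simp only [tangent]
  linear_combination curvature p m * htransfer - 1 / 2 * hm.curvature_mul

theorem gameValue_add_tangent_zero {θ : ℝ} (hθ : θ ∈ Ioc (1 / 2) p) :
    gameValue p m + tangent p m 0 θ =
      1 - (tangent p m p (fB p θ) - tangent p m p p) + tangent p m (1 - p) (fB p θ) := by
  have htransfer := hm.tsum_sign_fB (φ := fun b => 3 * p - 1 - b) (ψ := fun _ => 1) hθ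
    (by fun_prop) continuousOn_const fun a ha => by
      rw [fB_of_half_le ha.1.le]
      ring
  simp only [mul_one] at htransfer
  have hhalf := hm.signedMass_half
  have hslope := hm.tangent_sub 1 0 θ
  have hextrapolate := hm.tangent_sub (3 * p - 1) p (fB p θ)
  have hextrapolate' := hm.tangent_sub p (1 - p) (fB p θ)
  rw [signedMass] at hhalf hslope
  rw [hm.tsum_mul_sub, hm.apply_half, hhalf] at htransfer
  have hone := hm.gameValue_add_tangent_one hθ
  have hright := hm.tangent_right
  have hdef : tangent p m (3 * p - 1) (fB p θ) =
    -curvature p m * ∑' b, m b * (Real.sign (fB p θ - b) * (3 * p - 1 - b)) := rfl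
  linear_combination hone - hslope - hright - curvature p m * htransfer + hm.curvature_mul -
    hextrapolate + hextrapolate' + hdef

theorem tangent_right_right_le (τ : ℝ) : tangent p m p p ≤ tangent p m p τ := by
  rw [hm.tangent_right, ← hm.tsum_mul_sub, tangent]
  refine mul_le_mul_of_nonpos_left ?_ (neg_nonpos.2 hm.curvature_pos.le)
  refine (hm.summable_sign_mul_sub p τ).tsum_le_tsum (fun a => ?_) (hm.summable_mul (by fun_prop))
  by_cases ha : a ≤ p
  · exact mul_le_mul_of_nonneg_left (mul_le_of_le_one_left (sub_nonneg.2 ha)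
      (abs_le.1 (abs_sign_le_one _)).2) (hm.nonneg a)
  · rw [hm.apply_of_notMem a fun h => ha h.2, zero_mul, zero_mul]

theorem curvature_mul_sub_signedMass_le_one {τ : ℝ} (hτ : 1 - p < τ) :
    curvature p m * ((2 * p - 1) * (∑' a, m a - signedMass m τ)) ≤ 1 := by
  refine (mul_le_mul_of_nonneg_left ?_ hm.curvature_pos.le).trans_eq hm.curvature_mul
  have h := mul_le_mul_of_nonneg_left (hm.le_signedMass hτ)
    (by linarith [hm.half_le] : 0 ≤ 2 * p - 1)
  linarith

theorem tangent_right_le_add_one {τ : ℝ} (hτ : 1 - p < τ) :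
    tangent p m p τ ≤ tangent p m p p + 1 := by
  have hsum_sign := hm.summable_sign_mul_sub p τ
  have hsum : Summable fun a => m a * (p - a) := hm.summable_mul (by fun_prop)
  have hle : ∑' a, (m a * (p - a) - m a * (Real.sign (τ - a) * (p - a))) ≤
      ∑' a, (2 * p - 1) * (m a - m a * Real.sign (τ - a)) := by
    refine (hsum.sub hsum_sign).tsum_le_tsum (fun a => ?_)
      ((hm.summable.sub (hm.summable_sign τ)).mul_left _)
    by_cases ha : a ∈ Icc (1 - p) p
    · have hsign := sub_nonneg.2 (abs_le.1 (abs_sign_le_one (τ - a))).2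
      have := mul_le_mul_of_nonneg_left (by linarith [ha.1] : p - a ≤ 2 * p - 1)
        (mul_nonneg (hm.nonneg a) hsign)
      linarith
    · simp [hm.apply_of_notMem a ha]
  rw [hsum.tsum_sub hsum_sign, tsum_mul_left, hm.summable.tsum_sub (hm.summable_sign τ),
    hm.tsum_mul_sub] at hle
  have hbound := (mul_le_mul_of_nonneg_left hle hm.curvature_pos.le).trans
    (hm.curvature_mul_sub_signedMass_le_one hτ)
  rw [hm.tangent_right, tangent]
  linarith

theorem tangent_left_right_le {θ : ℝ} (hθ : θ ∈ Ioc (1 / 2) p) :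
    tangent p m (1 - p) p ≤ gameValue p m + tangent p m 0 θ := by
  have hτ : 1 - p < fB p θ := one_sub_lt_fB (hθ.1.trans_le hθ.2) hθ.1
  have hslope_right := hm.tangent_sub p (1 - p) p
  have hslope := hm.tangent_sub p (1 - p) (fB p θ)
  have hbound := hm.curvature_mul_sub_signedMass_le_one hτ
  have hmass : 0 ≤ curvature p m * ((2 * p - 1) * m p) :=
    mul_nonneg hm.curvature_pos.le (mul_nonneg (by linarith [hm.half_le]) (hm.nonneg p))
  rw [hm.signedMass_right] at hslope_right
  rw [hm.gameValue_add_tangent_zero hθ]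
  linarith

theorem tangent_right_left_le : tangent p m p (1 - p) ≤ 1 / 2 + tangent p m p p := by
  have hslope := hm.tangent_sub (1 - p) p p
  have hflip := hm.tangent_one_sub (1 - p) p
  have hcurv := hm.curvature_mul
  have hmass := hm.curvature_pos
  rw [hm.signedMass_right, ← hm.apply_left] at hslope
  rw [sub_sub_cancel] at hflip
  linarith

end IsKinkMass

/-- The value function of the belief `θ` of Player 2, up to an additive constant. Defined by one
step of the Bellman equation, it extends `θ ↦ tangent p m θ θ` from `[1 - p, p]` to arbitrary
initial beliefs. -/
noncomputable def beliefValue (p : ℝ) (m : ℝ → ℝ) (θ : ℝ) : ℝ :=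
  min θ (1 - θ) + (1 - θ) * tangent p m (fT p θ) (fT p θ) +
    θ * tangent p m (fB p θ) (fB p θ) - gameValue p m

namespace IsKinkMass

variable {p : ℝ} {m : ℝ → ℝ} (hm : IsKinkMass p m)

include hm

theorem gameValue_add_tangent_of_half_lt {θ : ℝ} (hθ : θ ∈ Ioc (1 / 2) p) :
    gameValue p m + tangent p m θ θ =
      1 - θ + (1 - θ) * tangent p m p p + θ * tangent p m (fB p θ) (fB p θ) := by
  have hbelief := mul_fB p θ
  rw [min_eq_right (by linarith [hθ.1])] at hbelief
  linear_combination hm.tangent_affine θ θ - θ * hm.tangent_affine (fB p θ) (fB p θ) +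
    (2 * θ - 1) * hm.tangent_affine p (fB p θ) + (1 - θ) * hm.tangent_affine (1 - p) (fB p θ) -
    hbelief * (tangent p m 1 (fB p θ) - tangent p m 0 (fB p θ)) +
    θ * hm.gameValue_add_tangent_one hθ + (1 - θ) * hm.gameValue_add_tangent_zero hθ

theorem gameValue_add_tangent_half :
    gameValue p m + tangent p m (1 / 2) (1 / 2) = 1 / 2 + tangent p m p p := by
  have h := hm.tangent_sub 1 (1 / 2) (1 / 2)
  rw [hm.signedMass_half, mul_zero, mul_zero] at h
  rw [gameValue]
  linarith

theorem beliefValue_one_sub (θ : ℝ) : beliefValue p m (1 - θ) = beliefValue p m θ := by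
  rw [beliefValue, beliefValue, fT_one_sub, fB_one_sub, hm.tangent_one_sub, hm.tangent_one_sub,
    sub_sub_cancel, min_comm]
  ring

theorem beliefValue_of_mem {θ : ℝ} (hθ : θ ∈ Icc (1 - p) p) :
    beliefValue p m θ = tangent p m θ θ := by
  wlog hhalf : 1 / 2 ≤ θ generalizing θ
  · rw [← hm.tangent_one_sub, ← hm.beliefValue_one_sub]
    exact this (one_sub_mem_Icc_iff.2 hθ) (by linarith)
  rw [beliefValue, min_eq_right (by linarith), fT_of_half_le hhalf]
  rcases hhalf.eq_or_lt with rfl | hlt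
  · rw [fB_half, hm.tangent_one_sub]
    linarith [hm.gameValue_add_tangent_half]
  · linarith [hm.gameValue_add_tangent_of_half_lt ⟨hlt, hθ.2⟩]

theorem gameValue_add_beliefValue {θ : ℝ} (hθ : θ ∈ I) :
    gameValue p m + beliefValue p m θ =
      min θ (1 - θ) + (1 - θ) * beliefValue p m (fT p θ) + θ * beliefValue p m (fB p θ) := by
  rw [hm.beliefValue_of_mem (fT_mem_Icc hm.half_le hθ.1),
    hm.beliefValue_of_mem (fB_mem_Icc hm.half_le hθ.2), beliefValue]
  ring

theorem exists_abs_beliefValue_le : ∃ K, ∀ θ ∈ I, |beliefValue p m θ| ≤ K := by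
  set K := curvature p m * ∑' a, m a
  refine ⟨1 + K + K + |gameValue p m|, fun θ hθ => ?_⟩
  have hbound {τ : ℝ} (hτ : τ ∈ Icc (1 - p) p) : |tangent p m τ τ| ≤ K :=
    hm.abs_tangent_le ⟨by linarith [hτ.1, hm.le_one], hτ.2.trans hm.le_one⟩ τ
  have hT := hbound (fT_mem_Icc hm.half_le hθ.1)
  have hB := hbound (fB_mem_Icc hm.half_le hθ.2)
  have hmin : |min θ (1 - θ)| ≤ 1 := by
    rw [abs_of_nonneg (le_min hθ.1 (sub_nonneg.2 hθ.2))]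
    exact (min_le_left _ _).trans hθ.2
  rw [beliefValue]
  refine (abs_sub _ _).trans (add_le_add_left ((abs_add_three _ _ _).trans ?_) _)
  rw [abs_mul, abs_mul, abs_of_nonneg hθ.1, abs_of_nonneg (sub_nonneg.2 hθ.2)]
  gcongr
  · exact (mul_le_of_le_one_left (abs_nonneg _) (sub_le_self 1 hθ.1)).trans hT
  · exact (mul_le_of_le_one_left (abs_nonneg _) hθ.2).trans hB

end IsKinkMass

/-! ### Expectations along a play -/

section Mean

variable {α β : Type*} {μ : PMF α}

/-- The expectation of `F` under `μ`, as the sum that appears in `averageGain`. It is only used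
for laws of finite support. -/
noncomputable def mean (μ : PMF α) (F : α → ℝ) : ℝ :=
  ∑' z, (μ z).toReal * F z

theorem summable_toReal_mul (hμ : μ.support.Finite) (F : α → ℝ) :
    Summable fun z => (μ z).toReal * F z := by
  refine summable_of_hasFiniteSupport (hμ.subset fun z hz => (PMF.mem_support_iff μ z).2 ?_)
  intro h
  exact hz (by simp [h])

theorem mean_add (hμ : μ.support.Finite) (F G : α → ℝ) :
    mean μ (fun z => F z + G z) = mean μ F + mean μ G := by
  simp only [mean, mul_add]
  exact (summable_toReal_mul hμ F).tsum_add (summable_toReal_mul hμ G)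

theorem mean_sub (hμ : μ.support.Finite) (F G : α → ℝ) :
    mean μ (fun z => F z - G z) = mean μ F - mean μ G := by
  simp only [mean, mul_sub]
  exact (summable_toReal_mul hμ F).tsum_sub (summable_toReal_mul hμ G)

theorem mean_const (μ : PMF α) (c : ℝ) : mean μ (fun _ => c) = c := by
  rw [mean, tsum_mul_right, ← ENNReal.tsum_toReal_eq μ.apply_ne_top, μ.tsum_coe,
    ENNReal.toReal_one, one_mul]

theorem mean_mono (hμ : μ.support.Finite) {F G : α → ℝ} (h : ∀ z, F z ≤ G z) :
    mean μ F ≤ mean μ G :=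
  (summable_toReal_mul hμ F).tsum_le_tsum
    (fun z => mul_le_mul_of_nonneg_left (h z) ENNReal.toReal_nonneg) (summable_toReal_mul hμ G)

theorem abs_mean_le (hμ : μ.support.Finite) {F : α → ℝ} {K : ℝ} (h : ∀ z, |F z| ≤ K) :
    |mean μ F| ≤ K := by
  have hlower := mean_mono hμ fun z => (abs_le.1 (h z)).1
  have hupper := mean_mono hμ fun z => (abs_le.1 (h z)).2
  rw [mean_const] at hlower hupper
  exact abs_le.2 ⟨hlower, hupper⟩

theorem support_bind_finite {f : α → PMF β} (hμ : μ.support.Finite)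
    (hf : ∀ a, (f a).support.Finite) : (μ.bind f).support.Finite := by
  rw [PMF.support_bind]
  exact hμ.biUnion fun a _ => hf a

theorem support_map_finite (g : α → β) (hμ : μ.support.Finite) :
    (μ.map g).support.Finite := by
  rw [PMF.support_map]
  exact hμ.image g

theorem mean_bind {f : α → PMF β} (hμ : μ.support.Finite) (hf : ∀ a, (f a).support.Finite)
    (F : β → ℝ) : mean (μ.bind f) F = mean μ fun a => mean (f a) F := by
  have hzero : ∀ a ∉ hμ.toFinset, μ a = 0 := fun a ha => by
    rwa [Set.Finite.mem_toFinset, PMF.mem_support_iff, not_not] at ha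
  have hbind (z : β) : ((μ.bind f) z).toReal * F z =
      ∑ a ∈ hμ.toFinset, (μ a).toReal * ((f a z).toReal * F z) := by
    rw [PMF.bind_apply, tsum_eq_sum fun a ha => by rw [hzero a ha, zero_mul],
      ENNReal.toReal_sum fun a _ => ENNReal.mul_ne_top (μ.apply_ne_top a) ((f a).apply_ne_top z),
      Finset.sum_mul]
    simp only [ENNReal.toReal_mul, mul_assoc]
  simp only [mean, hbind]
  rw [Summable.tsum_finsetSum fun a _ => (summable_toReal_mul (hf a) F).mul_left _,
    tsum_eq_sum fun a ha => by rw [hzero a ha, ENNReal.toReal_zero, zero_mul]]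
  simp only [tsum_mul_left]

theorem mean_map (g : α → β) (hμ : μ.support.Finite) (F : β → ℝ) :
    mean (μ.map g) F = mean μ fun a => F (g a) := by
  have hpure (b : β) : mean (PMF.pure b) F = F b := by
    rw [mean, tsum_eq_single b fun c hc => by simp [hc]]
    simp
  rw [PMF.map, mean_bind hμ fun a => by simp]
  simp only [Function.comp_apply, hpure]

end Mean

theorem support_choice_finite {α : Type} (t : I) (x y : α) : (choice t x y).support.Finite :=
  support_map_finite _ (Set.toFinite _)

theorem mean_choice {α : Type} (t : I) (x y : α) (F : α → ℝ) :
    mean (choice t x y) F = t * F x + (1 - t) * F y := by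
  rw [choice, mean_map _ (Set.toFinite _), mean, tsum_fintype, Fintype.sum_bool]
  simp only [PMF.ofFintype_apply, if_true, Bool.false_eq_true, if_false]
  rw [ENNReal.toReal_ofReal t.2.1, ENNReal.toReal_ofReal (sub_nonneg.2 t.2.2)]

/-- The probability that the state that follows `s` is `lo`. -/
def probLo (p : ℝ) : State → ℝ
  | State.lo => p
  | State.hi => 1 - p

theorem support_nextState_finite (p : I) (s : State) : (nextState p s).support.Finite := by
  cases s <;> exact support_choice_finite _ _ _

theorem mean_nextState (p : I) (s : State) (F : State → ℝ) :
    mean (nextState p s) F = probLo p s * F State.lo + (1 - probLo p s) * F State.hi := by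
  cases s <;> simp only [nextState, mean_choice, probLo]
  ring

/-- The law of the history and the state one stage after `z`. -/
noncomputable def stageLaw (p : I) (s₁ : Strategy₁) (s₂ : Strategy₂) (z : List Stage × State) :
    PMF (List Stage × State) :=
  (choice (s₁ z.1 z.2) Move₁.T Move₁.B).bind fun a =>
    (choice (s₂ (z.1.map Prod.snd)) Move₂.L Move₂.R).bind fun b =>
      (nextState p z.2).map fun s' => ((z.2, a, b) :: z.1, s')

/-- The total gain of Player 1 in the past stages. -/
def totalGain (z : List Stage × State) : ℝ := (z.1.map payoff).sum

/-- The expected gain of the move `a` in the state `s` if Player 2 plays `L` with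
probability `y`. -/
def moveGain (y : ℝ) (s : State) (a : Move₁) : ℝ :=
  y * payoff (s, a, Move₂.L) + (1 - y) * payoff (s, a, Move₂.R)

/-- The expected gain in the state `s` if the players play `T` and `L` with probabilities `x`
and `y`. -/
def stageGain (x y : ℝ) (s : State) : ℝ :=
  x * moveGain y s Move₁.T + (1 - x) * moveGain y s Move₁.B

/-- The expected change of `F` in the stage that follows `z`. -/
noncomputable def drift (p : I) (s₁ : Strategy₁) (s₂ : Strategy₂) (F : List Stage × State → ℝ)
    (z : List Stage × State) : ℝ :=
  mean (stageLaw p s₁ s₂ z) F - F z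

section Play

variable (p q : I) (s₁ : Strategy₁) (s₂ : Strategy₂)

theorem support_stageLaw_finite (z : List Stage × State) :
    (stageLaw p s₁ s₂ z).support.Finite :=
  support_bind_finite (support_choice_finite _ _ _) fun _ =>
    support_bind_finite (support_choice_finite _ _ _) fun _ =>
      support_map_finite _ (support_nextState_finite _ _)

theorem mean_stageLaw (z : List Stage × State) (F : List Stage × State → ℝ) :
    mean (stageLaw p s₁ s₂ z) F =
      mean (choice (s₁ z.1 z.2) Move₁.T Move₁.B) fun a =>
        mean (choice (s₂ (z.1.map Prod.snd)) Move₂.L Move₂.R) fun b =>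
          mean (nextState p z.2) fun s' => F ((z.2, a, b) :: z.1, s') := by
  have hnext (a : Move₁) (b : Move₂) :
      ((nextState p z.2).map fun s' => ((z.2, a, b) :: z.1, s')).support.Finite :=
    support_map_finite _ (support_nextState_finite _ _)
  rw [stageLaw, mean_bind (support_choice_finite _ _ _) fun a =>
    support_bind_finite (support_choice_finite _ _ _) (hnext a)]
  simp only [mean_bind (support_choice_finite _ _ _) (hnext _),
    mean_map _ (support_nextState_finite _ _)]

theorem support_playLaw_finite (n : ℕ) : (playLaw p q s₁ s₂ n).support.Finite := by
  induction n with
  | zero => exact support_map_finite _ (support_choice_finite _ _ _)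
  | succ n ih => exact support_bind_finite ih (support_stageLaw_finite p s₁ s₂)

theorem mean_playLaw_succ (n : ℕ) (F : List Stage × State → ℝ) :
    mean (playLaw p q s₁ s₂ (n + 1)) F =
      mean (playLaw p q s₁ s₂ n) fun z => mean (stageLaw p s₁ s₂ z) F :=
  mean_bind (support_playLaw_finite p q s₁ s₂ n) (support_stageLaw_finite p s₁ s₂) F

theorem sum_mean_drift (F : List Stage × State → ℝ) (n : ℕ) :
    ∑ k ∈ Finset.range n, mean (playLaw p q s₁ s₂ k) (drift p s₁ s₂ F) =
      mean (playLaw p q s₁ s₂ n) F - mean (playLaw p q s₁ s₂ 0) F := by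
  rw [← Finset.sum_range_sub fun k => mean (playLaw p q s₁ s₂ k) F]
  refine Finset.sum_congr rfl fun k _ => ?_
  rw [mean_playLaw_succ]
  exact mean_sub (support_playLaw_finite p q s₁ s₂ k) _ F

theorem drift_totalGain_add (H : List Stage × State → ℝ) (z : List Stage × State) :
    drift p s₁ s₂ (fun z => totalGain z + H z) z =
      stageGain (s₁ z.1 z.2) (s₂ (z.1.map Prod.snd)) z.2 + drift p s₁ s₂ H z := by
  simp only [drift, mean_stageLaw, mean_choice, mean_nextState, totalGain, List.map_cons,
    List.sum_cons, stageGain, moveGain]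
  ring

variable {p q s₁ s₂} {H : List Stage × State → ℝ} {K v : ℝ}

theorem tendsto_averageGain_sub (hH : ∀ z, |H z| ≤ K) :
    Tendsto (fun n : ℕ => averageGain p q s₁ s₂ n - (n : ℝ)⁻¹ * ∑ k ∈ Finset.range n,
      mean (playLaw p q s₁ s₂ k) (drift p s₁ s₂ fun z => totalGain z + H z)) atTop (nhds 0) := by
  have hfin := support_playLaw_finite p q s₁ s₂
  have hzero : mean (playLaw p q s₁ s₂ 0) totalGain = 0 := by
    rw [playLaw, mean_map _ (support_choice_finite _ _ _)]
    exact mean_const _ 0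
  have hbound (n : ℕ) : |mean (playLaw p q s₁ s₂ n) H| ≤ K := abs_mean_le (hfin n) hH
  refine squeeze_zero_norm (fun n => ?_) (tendsto_const_div_atTop_nhds_zero_nat (K + K))
  have havg : averageGain p q s₁ s₂ n = mean (playLaw p q s₁ s₂ n) totalGain / n := rfl
  rw [sum_mean_drift, mean_add (hfin n), mean_add (hfin 0), hzero, havg, div_eq_inv_mul, ← mul_sub,
    norm_mul, norm_inv, Real.norm_natCast, ← div_eq_inv_mul, Real.norm_eq_abs]
  gcongr
  rw [show ∀ x y z : ℝ, x - (x + y - (0 + z)) = z - y by intros; ring]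
  exact (abs_sub _ _).trans (add_le_add (hbound 0) (hbound n))

theorem tendsto_averageGain_of_tendsto_mean_drift (hH : ∀ z, |H z| ≤ K)
    (h : Tendsto (fun k => mean (playLaw p q s₁ s₂ k)
      (drift p s₁ s₂ fun z => totalGain z + H z)) atTop (nhds v)) :
    Tendsto (averageGain p q s₁ s₂) atTop (nhds v) := by
  simpa only [sub_add_cancel, zero_add] using
    (tendsto_averageGain_sub (p := p) (q := q) (s₁ := s₁) (s₂ := s₂) hH).add h.cesaro

theorem guarantees₂_of_drift_le (hH : ∀ z, |H z| ≤ K)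
    (h : ∀ s₁ z, drift p s₁ s₂ (fun z => totalGain z + H z) z ≤ v) : Guarantees₂ p s₂ v := by
  intro q s₁ w hw
  have hlim := tendsto_averageGain_sub (p := p) (q := q) (s₁ := s₁) (s₂ := s₂) hH
  filter_upwards [hlim.eventually_lt_const (sub_pos.2 hw), eventually_gt_atTop 0] with n hn hn0
  have hmean (k : ℕ) : mean (playLaw p q s₁ s₂ k)
      (drift p s₁ s₂ fun z => totalGain z + H z) ≤ v :=
    (mean_mono (support_playLaw_finite p q s₁ s₂ k) (h s₁)).trans_eq (mean_const _ v)
  have hcesaro : (n : ℝ)⁻¹ * ∑ k ∈ Finset.range n, mean (playLaw p q s₁ s₂ k)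
      (drift p s₁ s₂ fun z => totalGain z + H z) ≤ v := by
    rw [inv_mul_le_iff₀ (Nat.cast_pos.2 hn0)]
    simpa using Finset.sum_le_card_nsmul (Finset.range n) _ v fun k _ => hmean k
  linarith

end Play

/-! ### The belief of Player 2 -/

/-- The indicator of the state `lo`, that is, the belief of somebody who knows the state. -/
def isLo : State → ℝ
  | State.lo => 1
  | State.hi => 0

/-- The internal state of `σ*` after the move `a`, as a function of the one before it. -/
noncomputable def update (p : ℝ) : Move₁ → ℝ → ℝ
  | Move₁.T => fT p
  | Move₁.B => fB p

/-- The probability of the move `a` if `T` is played with probability `x`. -/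
def moveProb (x : ℝ) : Move₁ → ℝ
  | Move₁.T => x
  | Move₁.B => 1 - x

/-- The internal state of `σ*`, as a function of the past moves of both players. -/
noncomputable def publicBelief (p θ₀ : I) (h : List (Move₁ × Move₂)) : ℝ :=
  belief p θ₀ (h.map Prod.fst)

/-- The exchange of the two states, which together with `Move₁.swap` and the exchange of `L` and
`R` is a symmetry of the game. -/
def State.swap : State → State
  | State.lo => State.hi
  | State.hi => State.lo

/-- The exchange of the two moves of Player 1, see `State.swap`. -/
def Move₁.swap : Move₁ → Move₁
  | Move₁.T => Move₁.B
  | Move₁.B => Move₁.T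

theorem isLo_swap (s : State) : isLo s.swap = 1 - isLo s := by
  cases s <;> simp [isLo, State.swap]

theorem probLo_swap (p : ℝ) (s : State) : probLo p s.swap = 1 - probLo p s := by
  cases s <;> simp [probLo, State.swap]

theorem moveGain_swap (y : ℝ) (s : State) (a : Move₁) :
    moveGain (1 - y) s.swap a.swap = moveGain y s a := by
  cases s <;> cases a <;> simp [moveGain, payoff, State.swap, Move₁.swap]

theorem update_swap (p θ : ℝ) (a : Move₁) : update p a.swap (1 - θ) = 1 - update p a θ := by
  cases a
  · exact fB_one_sub p θ
  · exact fT_one_sub p θ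

theorem probT_swap (θ : ℝ) (s : State) : probT (1 - θ) s.swap = 1 - probT θ s := by
  rcases lt_trichotomy θ (1 / 2) with h | rfl | h
  · have : 1 - θ ≠ 0 := by linarith
    cases s <;> simp only [probT, State.swap, if_pos h.le, if_neg (by linarith : ¬1 - θ ≤ 1 / 2)]
    · ring
    · field_simp
      ring
  · cases s <;> norm_num [probT, State.swap]
  · have : θ ≠ 0 := by linarith
    cases s <;> simp only [probT, State.swap, if_neg h.not_ge, if_pos (by linarith : 1 - θ ≤ 1 / 2)]
    · rw [sub_sub_cancel]
      field_simp
      ring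
    · ring

theorem moveProb_swap (x : ℝ) (a : Move₁) : moveProb (1 - x) a.swap = moveProb x a := by
  cases a <;> simp [moveProb, Move₁.swap]

section PublicBelief

variable (p θ₀ : I)

theorem publicBelief_cons (a : Move₁) (b : Move₂) (h : List (Move₁ × Move₂)) :
    publicBelief p θ₀ ((a, b) :: h) = update p a (publicBelief p θ₀ h) := by
  cases a <;> rfl

theorem publicBelief_mem (h : List (Move₁ × Move₂)) : publicBelief p θ₀ h ∈ I :=
  (belief p θ₀ _).2

end PublicBelief

theorem update_mem_Icc {p θ : ℝ} (hp : 1 / 2 ≤ p) (hθ : θ ∈ I) (a : Move₁) :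
    update p a θ ∈ Icc (1 - p) p := by
  cases a
  · exact fT_mem_Icc hp hθ.1
  · exact fB_mem_Icc hp hθ.2

theorem publicBelief_self_mem_Icc {p : I} (hp : 1 / 2 ≤ (p : ℝ)) (h : List (Move₁ × Move₂)) :
    publicBelief p p h ∈ Icc (1 - p : ℝ) p := by
  cases h with
  | nil => exact ⟨(by linarith : (1 - p : ℝ) ≤ p), le_rfl⟩
  | cons c h =>
    rw [publicBelief_cons]
    exact update_mem_Icc hp (publicBelief_mem p p h) c.1

/-! ### An optimal strategy of Player 2 -/

/-- The probability with which the optimal strategy of Player 2 plays `L` at the belief `θ`. For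
`θ > 1 / 2` it makes Player 1 indifferent between `T` and `B` in the state `lo`. -/
noncomputable def probL (p : ℝ) (m : ℝ → ℝ) (θ : ℝ) : ℝ :=
  if 1 / 2 < θ then tangent p m p (fB p θ) - tangent p m p p
  else if θ < 1 / 2 then 1 - (tangent p m p (fB p (1 - θ)) - tangent p m p p)
  else 1 / 2

theorem probL_one_sub (p : ℝ) (m : ℝ → ℝ) (θ : ℝ) : probL p m (1 - θ) = 1 - probL p m θ := by
  rcases lt_trichotomy θ (1 / 2) with h | rfl | h
  · rw [probL, probL, if_pos (by linarith), if_neg h.not_gt, if_pos h, sub_sub_cancel]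
  · norm_num [probL]
  · rw [probL, probL, if_pos h, if_neg (by linarith), if_pos (by linarith), sub_sub_cancel]

namespace IsKinkMass

variable {p : ℝ} {m : ℝ → ℝ} (hm : IsKinkMass p m)

include hm

theorem probL_mem {θ : ℝ} (hθ : θ ∈ Icc (1 - p) p) : probL p m θ ∈ I := by
  wlog hhalf : 1 / 2 ≤ θ generalizing θ
  · have h := this (one_sub_mem_Icc_iff.2 hθ) (by linarith)
    rw [probL_one_sub] at h
    exact ⟨by linarith [h.2], by linarith [h.1]⟩
  rcases hhalf.eq_or_lt with rfl | hlt
  · norm_num [probL]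
  · have hτ : 1 - p < fB p θ := one_sub_lt_fB (hlt.trans_le hθ.2) hlt
    rw [probL, if_pos hlt]
    exact ⟨sub_nonneg.2 (hm.tangent_right_right_le _),
      by linarith [hm.tangent_right_le_add_one hτ]⟩

theorem moveGain_probL_add_tangent_le_of_half_lt {θ : ℝ} (hθ : θ ∈ Ioc (1 / 2) p) (s : State)
    (a : Move₁) :
    moveGain (probL p m θ) s a + tangent p m (probLo p s) (update p a θ) ≤
      gameValue p m + tangent p m (isLo s) θ := by
  rw [probL, if_pos hθ.1]
  cases s <;> cases a <;>
    simp only [moveGain, payoff, probLo, update, isLo, fT_of_half_le hθ.1.le]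
  · linarith [hm.gameValue_add_tangent_one hθ]
  · linarith [hm.gameValue_add_tangent_one hθ]
  · linarith [hm.tangent_left_right_le hθ]
  · linarith [hm.gameValue_add_tangent_zero hθ]

theorem moveGain_probL_add_tangent_le_half (s : State) (a : Move₁) :
    moveGain (probL p m (1 / 2)) s a + tangent p m (probLo p s) (update p a (1 / 2)) ≤
      gameValue p m + tangent p m (isLo s) (1 / 2) := by
  have hvalue := hm.gameValue_add_tangent_half
  have hcross := hm.tangent_right_left_le
  have hflip := hm.tangent_one_sub p (1 - p)
  have hright := hm.tangent_one_sub p p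
  have hconst := hm.tangent_sub (isLo s) (1 / 2) (1 / 2)
  rw [sub_sub_cancel] at hflip
  rw [hm.signedMass_half, mul_zero, mul_zero, sub_eq_zero] at hconst
  have hprob : probL p m (1 / 2) = 1 / 2 := by norm_num [probL]
  rw [hconst, hvalue, hprob]
  cases s <;> cases a <;>
    simp only [moveGain, payoff, probLo, update, fT_of_half_le le_rfl, fB_half] <;> linarith

theorem moveGain_probL_add_tangent_le {θ : ℝ} (hθ : θ ∈ Icc (1 - p) p) (s : State) (a : Move₁) :
    moveGain (probL p m θ) s a + tangent p m (probLo p s) (update p a θ) ≤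
      gameValue p m + tangent p m (isLo s) θ := by
  wlog hhalf : 1 / 2 ≤ θ generalizing θ s a
  · have h := this (one_sub_mem_Icc_iff.2 hθ) s.swap a.swap (by linarith)
    rwa [probL_one_sub, moveGain_swap, probLo_swap, update_swap, isLo_swap, hm.tangent_one_sub,
      hm.tangent_one_sub] at h
  rcases hhalf.eq_or_lt with rfl | hlt
  · exact hm.moveGain_probL_add_tangent_le_half s a
  · exact hm.moveGain_probL_add_tangent_le_of_half_lt ⟨hlt, hθ.2⟩ s a

end IsKinkMass

/-- The optimal strategy of Player 2: it plays `L` with probability `probL p m θ`, where `θ` is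
the internal state of `σ*` with initial value `p`. With this initial value `θ` stays in
`[1 - p, p]`, where `probL p m` has values in `[0, 1]` and `projIcc` has no effect. -/
noncomputable def tauStar (p : I) (m : ℝ → ℝ) : Strategy₂ := fun h =>
  projIcc 0 1 zero_le_one (probL p m (publicBelief p p h))

namespace IsKinkMass

variable {p : I} {m : ℝ → ℝ} (hm : IsKinkMass p m)

include hm

theorem coe_tauStar (h : List (Move₁ × Move₂)) :
    (tauStar p m h : ℝ) = probL p m (publicBelief p p h) := by
  rw [tauStar, projIcc_of_mem _ (hm.probL_mem (publicBelief_self_mem_Icc hm.half_le h))]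

theorem guarantees₂_tauStar : Guarantees₂ p (tauStar p m) (gameValue p m) := by
  refine guarantees₂_of_drift_le
    (H := fun z => tangent p m (isLo z.2) (publicBelief p p (z.1.map Prod.snd)))
    (fun z => hm.abs_tangent_le (by cases z.2 <;> simp [isLo]) _) fun s₁ z => ?_
  obtain ⟨hist, s⟩ := z
  have hle := hm.moveGain_probL_add_tangent_le
    (publicBelief_self_mem_Icc hm.half_le (hist.map Prod.snd)) s
  have hT := mul_le_mul_of_nonneg_left (hle Move₁.T) (s₁ hist s).2.1
  have hB := mul_le_mul_of_nonneg_left (hle Move₁.B) (sub_nonneg.2 (s₁ hist s).2.2)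
  rw [hm.tangent_affine (probLo p s)] at hT hB
  have hlo : isLo State.lo = 1 := rfl
  have hhi : isLo State.hi = 0 := rfl
  rw [drift_totalGain_add, drift, mean_stageLaw]
  simp only [mean_choice, mean_nextState, List.map_cons, publicBelief_cons, hlo, hhi, stageGain,
    hm.coe_tauStar]
  linarith

end IsKinkMass

/-! ### Optimality of `σ*` -/

section Bayes

variable (p θ : ℝ)

theorem mul_probT_lo : θ * probT θ State.lo = min θ (1 - θ) := by
  rw [probT]
  split_ifs with h
  · rw [mul_one, min_eq_left (by linarith)]
  · rw [mul_div_cancel₀ _ (by linarith), min_eq_right (by linarith)]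

theorem one_sub_mul_probT_hi : (1 - θ) * probT θ State.hi = 1 - θ - min θ (1 - θ) := by
  rw [probT]
  split_ifs with h
  · rw [mul_div_cancel₀ _ (by linarith), min_eq_left (by linarith)]
    ring
  · rw [mul_zero, min_eq_right (by linarith), sub_self]

/-- Bayes' rule: `update p a θ` is the probability of `lo` in the next stage, given the move `a`
of `σ*`. -/
theorem bayes (a : Move₁) :
    θ * moveProb (probT θ State.lo) a * (p - update p a θ) +
      (1 - θ) * moveProb (probT θ State.hi) a * (1 - p - update p a θ) = 0 := by
  cases a <;> simp only [moveProb, update]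
  · linear_combination (p - fT p θ) * mul_probT_lo θ +
      (1 - p - fT p θ) * one_sub_mul_probT_hi θ - one_sub_mul_fT p θ
  · linear_combination -(p - fB p θ) * mul_probT_lo θ -
      (1 - p - fB p θ) * one_sub_mul_probT_hi θ - mul_fB p θ

/-- The factor by which the move `a` of `σ*` multiplies the error `isLo s - θ` of the internal
state, in expectation over the next state and weighted with the probability of the move. -/
noncomputable def errorFactor (a : Move₁) : ℝ :=
  moveProb (probT θ State.lo) a * (p - update p a θ) -
    moveProb (probT θ State.hi) a * (1 - p - update p a θ)

theorem moveProb_mul_probLo_sub_update (s : State) (a : Move₁) :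
    moveProb (probT θ s) a * (probLo p s - update p a θ) = (isLo s - θ) * errorFactor p θ a := by
  cases s <;> simp only [probLo, isLo, errorFactor]
  · linear_combination bayes p θ a
  · linear_combination bayes p θ a

theorem errorFactor_swap (a : Move₁) : errorFactor p (1 - θ) a.swap = errorFactor p θ a := by
  have hlo := probT_swap θ State.lo
  have hhi := probT_swap θ State.hi
  simp only [State.swap] at hlo hhi
  simp only [errorFactor, hlo, hhi, moveProb_swap, update_swap]
  ring

variable {p θ}

theorem sum_abs_errorFactor_le (hp : 1 / 2 ≤ p) :
    |errorFactor p θ Move₁.T| + |errorFactor p θ Move₁.B| ≤ 2 * p - 1 := by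
  wlog hhalf : 1 / 2 ≤ θ generalizing θ
  · rw [← errorFactor_swap, ← errorFactor_swap p θ Move₁.B, add_comm]
    exact this (by linarith)
  have hθ : θ ≠ 0 := by linarith
  have hlo : probT θ State.lo = (1 - θ) / θ := by
    rw [eq_div_iff hθ, mul_comm, mul_probT_lo, min_eq_right (by linarith)]
  have hhi : probT θ State.hi = 0 := by
    have h := probT_swap θ State.hi
    rw [State.swap, probT, if_pos (by linarith)] at h
    linarith
  have hT : errorFactor p θ Move₁.T = 0 := by
    simp only [errorFactor, moveProb, update, fT_of_half_le hhalf, hhi]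
    ring
  have hB : errorFactor p θ Move₁.B = (2 * p - 1) * ((2 * θ - 1) / θ ^ 2) := by
    simp only [errorFactor, moveProb, update, fB_of_half_le hhalf, hlo, hhi]
    field_simp
    ring
  have hratio : 0 ≤ (2 * θ - 1) / θ ^ 2 := div_nonneg (by linarith) (sq_nonneg θ)
  have hratio_le : (2 * θ - 1) / θ ^ 2 ≤ 1 := by
    rw [div_le_one (by positivity)]
    linarith [sq_nonneg (θ - 1)]
  rw [hT, hB, abs_zero, zero_add, abs_of_nonneg (mul_nonneg (by linarith) hratio)]
  exact mul_le_of_le_one_right (by linarith) hratio_le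

end Bayes

section BeliefError

variable {p θ₀ : I} {s₂ : Strategy₂} {ψ : List (Move₁ × Move₂) → ℝ} {K : ℝ}

theorem coe_sigmaStar (p θ₀ : I) (h : List Stage) (s : State) :
    (sigmaStar p θ₀ h s : ℝ) = probT (publicBelief p θ₀ (h.map Prod.snd)) s := by
  rw [publicBelief, List.map_map]
  rfl

/-- The error of the internal state of `σ*` as an estimate of the current state. -/
noncomputable def beliefError (p θ₀ : I) (z : List Stage × State) : ℝ :=
  isLo z.2 - publicBelief p θ₀ (z.1.map Prod.snd)

theorem abs_beliefError_le_one (p θ₀ : I) (z : List Stage × State) : |beliefError p θ₀ z| ≤ 1 := by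
  obtain ⟨h0, h1⟩ := publicBelief_mem p θ₀ (z.1.map Prod.snd)
  rw [beliefError, abs_le]
  cases z.2 <;> simp only [isLo] <;> constructor <;> linarith

/-- The test function `ψ` pulled back by one stage: the expectation of `ψ` against `beliefError`
after a stage is that of `errorTransfer p θ₀ s₂ ψ` before it. -/
noncomputable def errorTransfer (p θ₀ : I) (s₂ : Strategy₂) (ψ : List (Move₁ × Move₂) → ℝ)
    (h : List (Move₁ × Move₂)) : ℝ :=
  errorFactor p (publicBelief p θ₀ h) Move₁.T *
      mean (choice (s₂ h) Move₂.L Move₂.R) (fun b => ψ ((Move₁.T, b) :: h)) +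
    errorFactor p (publicBelief p θ₀ h) Move₁.B *
      mean (choice (s₂ h) Move₂.L Move₂.R) (fun b => ψ ((Move₁.B, b) :: h))

theorem mean_stageLaw_beliefError_mul (p θ₀ : I) (s₂ : Strategy₂)
    (ψ : List (Move₁ × Move₂) → ℝ) (z : List Stage × State) :
    mean (stageLaw p (sigmaStar p θ₀) s₂ z)
        (fun z => beliefError p θ₀ z * ψ (z.1.map Prod.snd)) =
      beliefError p θ₀ z * errorTransfer p θ₀ s₂ ψ (z.1.map Prod.snd) := by
  obtain ⟨hist, s⟩ := z
  have hT := moveProb_mul_probLo_sub_update p (publicBelief p θ₀ (hist.map Prod.snd)) s Move₁.T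
  have hB := moveProb_mul_probLo_sub_update p (publicBelief p θ₀ (hist.map Prod.snd)) s Move₁.B
  have hlo : isLo State.lo = 1 := rfl
  have hhi : isLo State.hi = 0 := rfl
  simp only [moveProb] at hT hB
  simp only [mean_stageLaw, mean_choice, mean_nextState, beliefError, errorTransfer,
    List.map_cons, publicBelief_cons, coe_sigmaStar, hlo, hhi]
  set h := hist.map Prod.snd
  linear_combination
    (s₂ h * ψ ((Move₁.T, Move₂.L) :: h) + (1 - s₂ h) * ψ ((Move₁.T, Move₂.R) :: h)) * hT +
      (s₂ h * ψ ((Move₁.B, Move₂.L) :: h) + (1 - s₂ h) * ψ ((Move₁.B, Move₂.R) :: h)) * hB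

theorem abs_errorTransfer_le (hp : 1 / 2 ≤ (p : ℝ)) (hψ : ∀ h, |ψ h| ≤ K)
    (h : List (Move₁ × Move₂)) : |errorTransfer p θ₀ s₂ ψ h| ≤ (2 * p - 1) * K := by
  have hK : 0 ≤ K := (abs_nonneg _).trans (hψ [])
  have hmean (a : Move₁) :
      |mean (choice (s₂ h) Move₂.L Move₂.R) fun b => ψ ((a, b) :: h)| ≤ K :=
    abs_mean_le (support_choice_finite _ _ _) fun b => hψ _
  calc |errorTransfer p θ₀ s₂ ψ h|
      ≤ |errorFactor p (publicBelief p θ₀ h) Move₁.T| * K +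
          |errorFactor p (publicBelief p θ₀ h) Move₁.B| * K := by
        refine (abs_add_le _ _).trans ?_
        rw [abs_mul, abs_mul]
        gcongr <;> exact hmean _
    _ ≤ (2 * p - 1) * K := by
        rw [← add_mul]
        exact mul_le_mul_of_nonneg_right (sum_abs_errorFactor_le hp) hK

theorem abs_mean_beliefError_mul_le (hp : 1 / 2 ≤ (p : ℝ)) (q : I) (hψ : ∀ h, |ψ h| ≤ K)
    (n : ℕ) :
    |mean (playLaw p q (sigmaStar p θ₀) s₂ n)
        (fun z => beliefError p θ₀ z * ψ (z.1.map Prod.snd))| ≤ (2 * p - 1) ^ n * K := by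
  induction n generalizing ψ K with
  | zero =>
    rw [pow_zero, one_mul]
    refine abs_mean_le (support_playLaw_finite _ _ _ _ 0) fun z => ?_
    rw [abs_mul]
    exact (mul_le_of_le_one_left (abs_nonneg _) (abs_beliefError_le_one p θ₀ z)).trans (hψ _)
  | succ n ih =>
    rw [mean_playLaw_succ]
    simp only [mean_stageLaw_beliefError_mul]
    rw [pow_succ, mul_assoc]
    exact ih (abs_errorTransfer_le hp hψ)

theorem tendsto_mean_beliefError_mul (hp : 1 / 2 ≤ (p : ℝ)) (hp1 : (p : ℝ) < 1) (q : I)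
    (hψ : ∀ h, |ψ h| ≤ K) :
    Tendsto (fun n => mean (playLaw p q (sigmaStar p θ₀) s₂ n)
      fun z => beliefError p θ₀ z * ψ (z.1.map Prod.snd)) atTop (nhds 0) := by
  have hpow := tendsto_pow_atTop_nhds_zero_of_lt_one
    (by linarith : 0 ≤ 2 * (p : ℝ) - 1) (by linarith)
  exact squeeze_zero_norm (abs_mean_beliefError_mul_le hp q hψ)
    (by simpa only [zero_mul] using hpow.mul_const K)

end BeliefError

/-- The expected gain of Player 1 in a stage plus the expected change of `beliefValue`, if the
internal state of `σ*` is `θ`, the state of the system is `s` and Player 2 plays `L` with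
probability `y`. -/
noncomputable def beliefDrift (p : ℝ) (m : ℝ → ℝ) (y θ : ℝ) (s : State) : ℝ :=
  stageGain (probT θ s) y s + probT θ s * beliefValue p m (fT p θ) +
    (1 - probT θ s) * beliefValue p m (fB p θ) - beliefValue p m θ

theorem drift_sigmaStar (p : I) (m : ℝ → ℝ) (θ₀ : I) (s₂ : Strategy₂)
    (z : List Stage × State) :
    drift p (sigmaStar p θ₀) s₂ (fun z => totalGain z +
        beliefValue p m (publicBelief p θ₀ (z.1.map Prod.snd))) z =
      beliefDrift p m (s₂ (z.1.map Prod.snd)) (publicBelief p θ₀ (z.1.map Prod.snd)) z.2 := by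
  rw [drift_totalGain_add, drift, mean_stageLaw]
  simp only [mean_choice, mean_nextState, List.map_cons, publicBelief_cons, coe_sigmaStar,
    beliefDrift, update]
  ring

theorem stageGain_mem {x y : ℝ} (hx : x ∈ I) (hy : y ∈ I) (s : State) : stageGain x y s ∈ I := by
  cases s <;> simp only [stageGain, moveGain, payoff, mul_zero, mul_one, add_zero, zero_add]
  · exact unitInterval.mul_mem hx hy
  · exact unitInterval.mul_mem (Icc.mem_iff_one_sub_mem.1 hx) (Icc.mem_iff_one_sub_mem.1 hy)

namespace IsKinkMass

variable {p : I} {m : ℝ → ℝ} (hm : IsKinkMass p m)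

include hm

/-- The internal state of `σ*` is fair: if it is the probability of `lo`, then the expected gain
and the expected change of `beliefValue` do not depend on the move of Player 2. -/
theorem mul_beliefDrift_add {θ : ℝ} (hθ : θ ∈ I) (y : ℝ) :
    θ * beliefDrift p m y θ State.lo + (1 - θ) * beliefDrift p m y θ State.hi =
      gameValue p m := by
  simp only [beliefDrift, stageGain, moveGain, payoff]
  linear_combination
    (y + beliefValue p m (fT p θ) - beliefValue p m (fB p θ)) * mul_probT_lo θ +
      (beliefValue p m (fT p θ) - beliefValue p m (fB p θ) - (1 - y)) *
        one_sub_mul_probT_hi θ - hm.gameValue_add_beliefValue hθ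

theorem beliefDrift_eq {θ : ℝ} (hθ : θ ∈ I) (y : ℝ) (s : State) :
    beliefDrift p m y θ s = gameValue p m +
      (isLo s - θ) * (beliefDrift p m y θ State.lo - beliefDrift p m y θ State.hi) := by
  rw [← hm.mul_beliefDrift_add hθ y]
  cases s <;> simp only [isLo] <;> ring

theorem exists_abs_beliefDrift_le :
    ∃ K, ∀ y ∈ I, ∀ θ ∈ I, ∀ s, |beliefDrift p m y θ s| ≤ K := by
  obtain ⟨K, hK⟩ := hm.exists_abs_beliefValue_le
  refine ⟨1 + K + K + K, fun y hy θ hθ s => ?_⟩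
  obtain ⟨hx0, hx1⟩ := probT_mem ⟨θ, hθ⟩ s
  have hgain := stageGain_mem ⟨hx0, hx1⟩ hy s
  refine (abs_sub _ _).trans (add_le_add ((abs_add_three _ _ _).trans ?_) (hK θ hθ))
  rw [abs_mul, abs_mul, abs_of_nonneg hgain.1, abs_of_nonneg hx0,
    abs_of_nonneg (sub_nonneg.2 hx1)]
  gcongr
  · exact hgain.2
  · exact (mul_le_of_le_one_left (abs_nonneg _) hx1).trans (hK _ (fT_mem p ⟨θ, hθ⟩))
  · exact (mul_le_of_le_one_left (abs_nonneg _) (sub_le_self 1 hx0)).trans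
      (hK _ (fB_mem p ⟨θ, hθ⟩))

theorem tendsto_averageGain_sigmaStar (θ₀ q : I) (s₂ : Strategy₂) :
    Tendsto (averageGain p q (sigmaStar p θ₀) s₂) atTop (nhds (gameValue p m)) := by
  obtain ⟨K, hK⟩ := hm.exists_abs_beliefValue_le
  obtain ⟨K', hK'⟩ := hm.exists_abs_beliefDrift_le
  let driftGap (h : List (Move₁ × Move₂)) : ℝ :=
    beliefDrift p m (s₂ h) (publicBelief p θ₀ h) State.lo -
      beliefDrift p m (s₂ h) (publicBelief p θ₀ h) State.hi
  have hgap (h : List (Move₁ × Move₂)) : |driftGap h| ≤ K' + K' :=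
    (abs_sub _ _).trans (add_le_add (hK' _ (s₂ h).2 _ (publicBelief_mem p θ₀ h) _)
      (hK' _ (s₂ h).2 _ (publicBelief_mem p θ₀ h) _))
  refine tendsto_averageGain_of_tendsto_mean_drift
    (H := fun z => beliefValue p m (publicBelief p θ₀ (z.1.map Prod.snd)))
    (fun z => hK _ (publicBelief_mem p θ₀ _)) ?_
  have hmean (n : ℕ) : mean (playLaw p q (sigmaStar p θ₀) s₂ n)
      (drift p (sigmaStar p θ₀) s₂ fun z => totalGain z +
        beliefValue p m (publicBelief p θ₀ (z.1.map Prod.snd))) = gameValue p m +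
      mean (playLaw p q (sigmaStar p θ₀) s₂ n)
        (fun z => beliefError p θ₀ z * driftGap (z.1.map Prod.snd)) := by
    rw [← mean_const (playLaw p q (sigmaStar p θ₀) s₂ n) (gameValue p m),
      ← mean_add (support_playLaw_finite _ _ _ _ _)]
    refine congrArg _ (funext fun z => ?_)
    rw [drift_sigmaStar, hm.beliefDrift_eq (publicBelief_mem p θ₀ _)]
    rfl
  have herror := tendsto_mean_beliefError_mul (θ₀ := θ₀) (s₂ := s₂) hm.half_le hm.lt_one q hgap
  simpa only [hmean, add_zero] using herror.const_add (gameValue p m)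

theorem guarantees₁_sigmaStar (θ₀ : I) : Guarantees₁ p (sigmaStar p θ₀) (gameValue p m) :=
  fun q s₂ _ hw => (hm.tendsto_averageGain_sigmaStar θ₀ q s₂).eventually_const_lt hw

end IsKinkMass

end AsymmetricGame

open AsymmetricGame unitInterval in
theorem mainTheorem2 (p : I) (hp : 1 / 2 ≤ (p : ℝ))
    (hpress : ∑' n : ℕ, pressureSum p n < ⊤) (θ₀ : I) :
    IsOptimal₁ p (sigmaStar p θ₀) := by
  have hm := isKinkMass_kinkMass hp p.2.2 hpress
  have hσ := hm.guarantees₁_sigmaStar θ₀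
  exact ⟨gameValue p _, ⟨⟨_, hσ⟩, ⟨_, hm.guarantees₂_tauStar⟩⟩, hσ⟩
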